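/- Let $k$ be a field, $V$ a finite-dimensional $k$-vector space, and $S=S_k(V)$ its symmetric algebra, $\mathbb Z$-graded with $\deg V=1$. All $S$-modules are $\mathbb Z$-graded, their homomorphisms and isomorphisms are homogeneous of degree $0$, and $M\{m\}_{\{n\}}=M_{\{m+n\}}$. Let $\mathcal G=(\mathcal V,\mathcal E,\alpha,\le)$ be a finite GKM moment graph over $V$ with a highest vertex $w$. That is: $(\mathcal V,\mathcal E)$ is a finite graph without loops or double edges; $\alpha\colon\mathcal E\to V\setminus\{0\}$ is a labelling such that the labels of any two distinct edges with a common vertex are linearly independent; $\le$ is a partial order on $\mathcal V$ such that the endpoints of each edge are comparable, it is generated by the edges directed upwards, and $x\le w$ for all $x\in\mathcal V$. A sheaf $\mathscr M$ on $\mathcal G$ consists of finitely generated torsion free graded $S$-modules $\mathscr M^x$ ($x\in\mathcal V$), finitely generated graded $S$-modules $\mathscr M^E$ with $\alpha(E)\mathscr M^E=0$ ($E\in\mathcal E$), and homomorphisms $\rho_{x,E}\colon\mathscr M^x\to\mathscr M^E$ of graded $S$-modules for each vertex $x$ of $E$. For $\Lambda\subset\mathcal V$ let $\Gamma(\Lambda,\mathscr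 M)$ be the set of all $(m_x)\in\bigoplus_{x\in\Lambda}\mathscr M^x$ with $\rho_{x,E}(m_x)=\rho_{y,E}(m_y)$ for all edges $E$ with endpoints $x,y\in\Lambda$, and let $\Gamma(\mathscr M)=\Gamma(\mathcal V,\mathscr M)$. For $x\in\mathcal V$ let $\mathcal E_{\delta x}$ be the set of edges joining $x$ to a vertex $y>x$, let $\rho_{x,\delta x}=(\rho_{x,E})_{E}\colon\mathscr M^x\to\bigoplus_{E\in\mathcal E_{\delta x}}\mathscr M^E$, and let $\mathscr M^{\delta x}\subset\bigoplus_{E\in\mathcal E_{\delta x}}\mathscr M^E$ be the image of $\Gamma(\{>x\},\mathscr M)$ under the maps $\rho_{y,E}$, where $y$ is the upper endpoint of $E$. Let $\mathscr B$ be the Braden--MacPherson sheaf on $\mathcal G$, i.e. the sheaf, unique up to isomorphism, such that (1) $\mathscr B^w\cong S$; (2) for each edge $E$ with label $\alpha$ and endpoints $x<y$, the map $\rho_{y,E}$ is surjective with kernel $\alpha\mathscr B^y$; (3) for each $x\neq w$ the image of $\rho_{x,\delta x}$ is $\mathscr B^{\delta x}$, and $\rho_{x,\delta x}\colon\mathscr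 B^x\to\mathscr B^{\delta x}$ is a projective cover in the category of graded $S$-modules. Let $\mathcal B=\Gamma(\mathscr B)$ be the intersection cohomology of $\mathcal G$, with stalks $\mathcal B^x=\mathscr B^x$. It is a graded module, under coordinatewise multiplication, over the structure algebra $\mathcal Z$ of all $(z_x)\in\bigoplus_{x\in\mathcal V}S$ with $z_x\equiv z_y \bmod \alpha(E)$ for all edges $E$ with endpoints $x,y$. Let $l\in\mathbb Z$ and assume that $\mathcal B$ is self-dual of degree $l$: there is an isomorphism $\operatorname{Hom}^\bullet_S(\mathcal B,S)\cong\mathcal B\{l\}$ of graded $\mathcal Z$-modules, where $\operatorname{Hom}_S^\bullet(\mathcal B,S)=\bigoplus_{n\in\mathbb Z}\operatorname{Hom}_S(\mathcal B,S\{n\})$ and $(z.f)(m)=f(z.m)$. Then for every $x\in\mathcal V$ the following are equivalent: 1. $\mathcal B^x\cong S$ (as graded $S$-modules). 2. For every $y\ge x$ there are exactly $l$ edges of $\mathcal G$ containing $y$. -/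

import Mathlib

universe u v w

open DirectSum

noncomputable section

namespace MomentGraphTheory

/-! ### The graded ring `S` and graded `S`-modules -/

section GradedModules

variable (k : Type u) [Field k] (V : Type v) [AddCommGroup V] [Module k V]

/-- The homogeneous component of degree `i` of the symmetric algebra `S = S_k(V)`, with
`deg V = 1`: the span of the `i`-fold products of elements of `V` for `i ≥ 0`, and zero for
`i < 0`. -/
def symDeg : ℤ → Submodule k (SymmetricAlgebra k V)
  | Int.ofNat n => LinearMap.range (SymmetricAlgebra.ι k V) ^ n
  | Int.negSucc _ => ⊥

theorem iota_mem_symDeg (a : V) : SymmetricAlgebra.ι k V a ∈ symDeg k V 1 := by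
  change _ ∈ LinearMap.range (SymmetricAlgebra.ι k V) ^ 1
  rw [pow_one]
  exact LinearMap.mem_range_self _ a

instance symDeg_gradedMonoid : SetLike.GradedMonoid (symDeg k V) where
  one_mem := by
    change _ ∈ LinearMap.range (SymmetricAlgebra.ι k V) ^ 0
    rw [pow_zero]
    exact Submodule.one_le.mp le_rfl
  mul_mem := by
    rintro (i | i) (j | j) a b ha hb
    · change _ ∈ LinearMap.range (SymmetricAlgebra.ι k V) ^ (i + j)
      rw [pow_add]
      exact Submodule.mul_mem_mul ha hb
    · have : b = 0 := (Submodule.mem_bot k).mp hb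
      subst this
      rw [mul_zero]
      exact Submodule.zero_mem _
    · have : a = 0 := (Submodule.mem_bot k).mp ha
      subst this
      rw [zero_mul]
      exact Submodule.zero_mem _
    · have : a = 0 := (Submodule.mem_bot k).mp ha
      subst this
      rw [zero_mul]
      exact Submodule.zero_mem _

/-- The inclusion of `V` as the degree one part, with values in the direct sum. -/
def symIota : V →ₗ[k] ⨁ i, symDeg k V i :=
  DirectSum.lof k ℤ (fun i => symDeg k V i) 1 ∘ₗ
    (SymmetricAlgebra.ι k V).codRestrict _ (iota_mem_symDeg k V)

theorem symIota_apply (a : V) : symIota k V a =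
    DirectSum.of (fun i => symDeg k V i) 1 ⟨SymmetricAlgebra.ι k V a, iota_mem_symDeg k V a⟩ :=
  rfl

/-- `S` is a graded algebra. -/
instance symGradedAlgebra : GradedAlgebra (symDeg k V) :=
  GradedAlgebra.ofAlgHom _ (SymmetricAlgebra.lift (symIota k V))
    (by
      apply SymmetricAlgebra.algHom_ext
      ext m
      change (DirectSum.coeAlgHom (symDeg k V)) (SymmetricAlgebra.lift (symIota k V)
        (SymmetricAlgebra.ι k V m)) = SymmetricAlgebra.ι k V m
      rw [SymmetricAlgebra.lift_ι_apply, symIota_apply, DirectSum.coeAlgHom_of])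
    (by
      rintro (i | i) ⟨x, hx⟩
      · change x ∈ LinearMap.range (SymmetricAlgebra.ι k V) ^ i at hx
        dsimp only [Subtype.coe_mk, DirectSum.lof_eq_of]
        induction hx using Submodule.pow_induction_on_left' with
        | algebraMap r =>
          rw [AlgHom.commutes, DirectSum.algebraMap_apply]; rfl
        | add x y i hx hy ihx ihy =>
          rw [map_add, ihx, ihy, ← map_add]
          rfl
        | mem_mul m hm i x hx ih =>
          obtain ⟨m, rfl⟩ := hm
          rw [map_mul, ih, SymmetricAlgebra.lift_ι_apply, symIota_apply, DirectSum.of_mul_of]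
          exact DirectSum.of_eq_of_gradedMonoid_eq
            (Sigma.subtype_ext (add_comm (1 : ℤ) (i : ℤ)) rfl)
      · have : x = 0 := (Submodule.mem_bot k).mp hx
        subst this
        rw [map_zero]
        exact (map_zero (DirectSum.of (fun i => symDeg k V i) _)).symm)

/-- A `ℤ`-graded module over the graded ring `S = S_k(V)`. -/
structure GrMod where
  carrier : Type (max u v)
  [addCommGroup : AddCommGroup carrier]
  [module : Module (SymmetricAlgebra k V) carrier]
  /-- the homogeneous components -/
  deg : ℤ → AddSubgroup carrier
  isInternal : DirectSum.IsInternal deg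
  smul_mem : ∀ (n i : ℤ) (s : SymmetricAlgebra k V) (m : carrier),
    s ∈ symDeg k V n → m ∈ deg i → s • m ∈ deg (n + i)

instance : CoeSort (GrMod k V) (Type (max u v)) := ⟨GrMod.carrier⟩

instance (M : GrMod k V) : AddCommGroup M := M.addCommGroup

instance (M : GrMod k V) : Module (SymmetricAlgebra k V) M := M.module

/-- `S` as a graded module over itself. -/
def GrMod.ring : GrMod k V where
  carrier := SymmetricAlgebra k V
  deg i := (symDeg k V i).toAddSubgroup
  isInternal := DirectSum.Decomposition.isInternal (symDeg k V)
  smul_mem _ _ _ _ hs hm := SetLike.GradedMul.mul_mem (A := symDeg k V) hs hm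

variable {k V}

namespace GrMod

/-- Homomorphisms of graded `S`-modules are homogeneous of degree zero. -/
def IsGradedHom {M N : GrMod k V} (f : M →ₗ[SymmetricAlgebra k V] N) : Prop :=
  ∀ (i : ℤ) (m : M), m ∈ M.deg i → f m ∈ N.deg i

/-- Two graded `S`-modules are isomorphic (by an isomorphism that is homogeneous of degree
zero). -/
def IsIso (M N : GrMod k V) : Prop :=
  ∃ e : M ≃ₗ[SymmetricAlgebra k V] N, ∀ (i : ℤ) (m : M), m ∈ M.deg i ↔ e m ∈ N.deg i

/-- Projective objects of the category of graded `S`-modules. -/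
def IsProjective (P : GrMod k V) : Prop :=
  ∀ (M N : GrMod k V) (p : M →ₗ[SymmetricAlgebra k V] N) (f : P →ₗ[SymmetricAlgebra k V] N),
    IsGradedHom p → IsGradedHom f → Function.Surjective p →
      ∃ g : P →ₗ[SymmetricAlgebra k V] M, IsGradedHom g ∧ p ∘ₗ g = f

/-- A graded (homogeneous) submodule: one that is generated by its homogeneous elements. -/
def IsHomogeneous {M : GrMod k V} (N : Submodule (SymmetricAlgebra k V) M) : Prop :=
  N ≤ Submodule.span (SymmetricAlgebra k V) {m : M | m ∈ N ∧ ∃ i : ℤ, m ∈ M.deg i}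

/-- A graded submodule `K` of `M` is superfluous if `N + K = M` forces `N = M`, for every graded
submodule `N` of `M`. -/
def IsSuperfluous {M : GrMod k V} (K : Submodule (SymmetricAlgebra k V) M) : Prop :=
  ∀ N : Submodule (SymmetricAlgebra k V) M, IsHomogeneous N → N ⊔ K = ⊤ → N = ⊤

end GrMod

end GradedModules

/-! ### Moment graphs -/

/-- A moment graph over `V` with vertex set `ι`, partially ordered. The underlying graph is
simple (no double edges; there are no loops as each edge gets a direction from the order). -/
structure MomentGraph (k : Type u) [Field k] (V : Type v) [AddCommGroup V] [Module k V]
    (ι : Type w) [PartialOrder ι] where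
  graph : SimpleGraph ι
  label : graph.edgeSet → V
  label_ne_zero : ∀ e, label e ≠ 0
  comparable : ∀ x y, graph.Adj x y → x < y ∨ y < x
  /-- The partial order is generated by the directed edges. -/
  generated : ∀ x y, x ≤ y → Relation.ReflTransGen (fun a b => graph.Adj a b ∧ a < b) x y

namespace MomentGraph

variable {k : Type u} [Field k] {V : Type v} [AddCommGroup V] [Module k V]
  {ι : Type w} [PartialOrder ι] (G : MomentGraph k V ι)

/-- GKM-graphs: the labels of two distinct edges with a common vertex are linearly
independent. -/
def IsGKM : Prop :=
  ∀ (x : ι) (e f : G.graph.edgeSet), e ≠ f → x ∈ (e : Sym2 ι) → x ∈ (f : Sym2 ι) →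
    LinearIndependent k ![G.label e, G.label f]

/-- The edge through two adjacent vertices. -/
abbrev edge {x y : ι} (h : G.graph.Adj x y) : G.graph.edgeSet :=
  ⟨s(x, y), (SimpleGraph.mem_edgeSet G.graph).mpr h⟩

/-- The label of an edge as an element (of degree one) of `S`. -/
def labelS (e : G.graph.edgeSet) : SymmetricAlgebra k V := SymmetricAlgebra.ι k V (G.label e)

/-- The number of edges of `G` that contain the vertex `x`. -/
def numEdges (x : ι) : ℕ := {e : G.graph.edgeSet | x ∈ (e : Sym2 ι)}.ncard

/-- The structure algebra `Z` of `G`: the tuples `(z_x)` in `⨁ S` (a finite direct sum, as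
`G` is finite) with `z_x ≡ z_y` modulo the label of each edge through `x` and `y`. -/
def structureAlgebra : Subalgebra (SymmetricAlgebra k V) (ι → SymmetricAlgebra k V) where
  carrier := {z | ∀ (x y : ι) (h : G.graph.Adj x y), G.labelS (G.edge h) ∣ z x - z y}
  mul_mem' := by
    intro a b ha hb x y h
    have : (a * b) x - (a * b) y = a x * (b x - b y) + (a x - a y) * b y := by
      simp only [Pi.mul_apply]; ring
    rw [this]
    exact dvd_add (Dvd.dvd.mul_left (hb x y h) _) (Dvd.dvd.mul_right (ha x y h) _)
  add_mem' := by
    intro a b ha hb x y h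
    have : (a + b) x - (a + b) y = (a x - a y) + (b x - b y) := by
      simp only [Pi.add_apply]; ring
    rw [this]
    exact dvd_add (ha x y h) (hb x y h)
  algebraMap_mem' := by
    intro r _ _ _
    simp

/-- A sheaf on the moment graph `G`. -/
structure Sheaf where
  stalk : ι → GrMod k V
  edgeMod : G.graph.edgeSet → GrMod k V
  rho : ∀ (x : ι) (e : G.graph.edgeSet), x ∈ (e : Sym2 ι) →
    (stalk x →ₗ[SymmetricAlgebra k V] edgeMod e)
  rho_graded : ∀ x e h, GrMod.IsGradedHom (rho x e h)
  stalk_finite : ∀ x, Module.Finite (SymmetricAlgebra k V) (stalk x)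
  stalk_torsionFree : ∀ x, Module.IsTorsionFree (SymmetricAlgebra k V) (stalk x)
  edge_finite : ∀ e, Module.Finite (SymmetricAlgebra k V) (edgeMod e)
  label_smul : ∀ (e : G.graph.edgeSet) (m : edgeMod e), G.labelS e • m = 0

namespace Sheaf

variable {G} (M : G.Sheaf)

/-- The restriction map from the stalk at `x` to the edge through the adjacent vertices `x` and
`y`. -/
abbrev resL {x y : ι} (h : G.graph.Adj x y) :
    M.stalk x →ₗ[SymmetricAlgebra k V] M.edgeMod (G.edge h) :=
  M.rho x (G.edge h) (Sym2.mem_mk_left x y)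

/-- The restriction map from the stalk at `y` to the edge through the adjacent vertices `x` and
`y`. -/
abbrev resR {x y : ι} (h : G.graph.Adj x y) :
    M.stalk y →ₗ[SymmetricAlgebra k V] M.edgeMod (G.edge h) :=
  M.rho y (G.edge h) (Sym2.mem_mk_right x y)

/-- The sections of `M` over a set `Λ` of vertices. -/
def sectionsOn (Λ : Set ι) : Submodule (SymmetricAlgebra k V) (∀ x : Λ, M.stalk x) where
  carrier := {m | ∀ (x y : Λ) (h : G.graph.Adj x y), M.resL h (m x) = M.resR h (m y)}
  add_mem' := by
    intro a b ha hb x y h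
    simp only [Pi.add_apply, map_add, ha x y h, hb x y h]
  zero_mem' := by
    intro x y h
    simp only [Pi.zero_apply, map_zero]
  smul_mem' := by
    intro c a ha x y h
    simp only [Pi.smul_apply, map_smul, ha x y h]

/-- The global sections `Γ(M)`. -/
def sections : Submodule (SymmetricAlgebra k V) (∀ x, M.stalk x) where
  carrier := {m | ∀ (x y : ι) (h : G.graph.Adj x y), M.resL h (m x) = M.resR h (m y)}
  add_mem' := by
    intro a b ha hb x y h
    simp only [Pi.add_apply, map_add, ha x y h, hb x y h]
  zero_mem' := by
    intro x y h
    simp only [Pi.zero_apply, map_zero]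
  smul_mem' := by
    intro c a ha x y h
    simp only [Pi.smul_apply, map_smul, ha x y h]

/-- The grading of `Γ(M)`. -/
def sectionsDeg (i : ℤ) : AddSubgroup M.sections where
  carrier := {m | ∀ x, m.1 x ∈ (M.stalk x).deg i}
  add_mem' := fun ha hb x => add_mem (ha x) (hb x)
  zero_mem' := fun _ => zero_mem _
  neg_mem' := fun ha x => neg_mem (ha x)

theorem smul_mem_sections (z : G.structureAlgebra) (m : M.sections) :
    (fun x => z.1 x • m.1 x) ∈ M.sections := by
  intro x y h
  have hm := m.2 x y h
  obtain ⟨s, hs⟩ := z.2 x y h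
  have hx : z.1 x = z.1 y + s * G.labelS (G.edge h) := by
    rw [mul_comm, ← hs]; ring
  change M.resL h (z.1 x • m.1 x) = M.resR h (z.1 y • m.1 y)
  rw [map_smul, map_smul, hm, hx, add_smul, mul_smul, M.label_smul, smul_zero, add_zero]

/-- `Γ(M)` is a `Z`-module by coordinatewise multiplication. -/
instance : Module G.structureAlgebra M.sections where
  smul z m := ⟨fun x => z.1 x • m.1 x, M.smul_mem_sections z m⟩
  one_smul m := Subtype.ext (funext fun x => one_smul _ (m.1 x))
  mul_smul a b m := Subtype.ext (funext fun x => mul_smul (a.1 x) (b.1 x) (m.1 x))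
  smul_zero a := Subtype.ext (funext fun x => smul_zero (a.1 x))
  smul_add a m n := Subtype.ext (funext fun x => smul_add (a.1 x) (m.1 x) (n.1 x))
  add_smul a b m := Subtype.ext (funext fun x => add_smul (a.1 x) (b.1 x) (m.1 x))
  zero_smul m := Subtype.ext (funext fun x => zero_smul _ (m.1 x))

/-- The vertices `y > x` that are connected to `x` by an edge. They index the edges that start
at `x`. -/
abbrev Up (_M : G.Sheaf) (x : ι) : Type w := {y : ι // G.graph.Adj x y ∧ x < y}

/-- The map from the stalk at `x` to the direct sum of the modules on the edges that start at
`x`. -/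
def rhoUp (x : ι) :
    M.stalk x →ₗ[SymmetricAlgebra k V] ∀ y : M.Up x, M.edgeMod (G.edge y.2.1) :=
  LinearMap.pi fun y => M.resL y.2.1

/-- The image of the sections over `{> x}` in the direct sum of the modules on the edges that
start at `x`. -/
def upImage (x : ι) :
    Submodule (SymmetricAlgebra k V) (∀ y : M.Up x, M.edgeMod (G.edge y.2.1)) :=
  Submodule.map
    (LinearMap.pi fun y => M.resR y.2.1 ∘ₗ LinearMap.proj (⟨y.1, y.2.2⟩ : Set.Ioi x))
    (M.sectionsOn (Set.Ioi x))

/-- `M` is a Braden-MacPherson sheaf on the moment graph `G` with highest vertex `t`. Up to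
isomorphism there is exactly one such sheaf. The last three conditions say that the map from the
stalk at `x` to `upImage x` is a projective cover in the category of graded `S`-modules. -/
structure IsBradenMacPherson (t : ι) : Prop where
  top : (M.stalk t).IsIso (GrMod.ring k V)
  surjective : ∀ (x y : ι) (h : G.graph.Adj x y), x < y → Function.Surjective (M.resR h)
  ker : ∀ (x y : ι) (h : G.graph.Adj x y), x < y → ∀ m : M.stalk y,
    M.resR h m = 0 ↔ ∃ m' : M.stalk y, m = G.labelS (G.edge h) • m'
  range_rhoUp : ∀ x, x ≠ t → LinearMap.range (M.rhoUp x) = M.upImage x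
  projective : ∀ x, x ≠ t → (M.stalk x).IsProjective
  superfluous : ∀ x, x ≠ t → GrMod.IsSuperfluous (LinearMap.ker (M.rhoUp x))

end Sheaf

section Duality

variable {M : Type*} [AddCommGroup M] [Module (SymmetricAlgebra k V) M]

/-- `Hom_S(M, S{n})` for an `S`-module `M` with grading `deg`: the `S`-linear maps that send
`M_i` to `S_{n + i}`. -/
def homDeg (deg : ℤ → AddSubgroup M) (n : ℤ) :
    AddSubgroup (M →ₗ[SymmetricAlgebra k V] SymmetricAlgebra k V) where
  carrier := {f | ∀ (i : ℤ) (m : M), m ∈ deg i → f m ∈ symDeg k V (n + i)}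
  add_mem' := fun ha hb i m hm => add_mem (ha i m hm) (hb i m hm)
  zero_mem' := fun _ _ _ => zero_mem _
  neg_mem' := fun ha i m hm => neg_mem (ha i m hm)

/-- The dual `DM`, i.e. the (internal) direct sum of the `Hom_S(M, S{n})` over all `n`. -/
def gradedDual (deg : ℤ → AddSubgroup M) :
    AddSubgroup (M →ₗ[SymmetricAlgebra k V] SymmetricAlgebra k V) :=
  ⨆ n : ℤ, homDeg deg n

/-- A graded `Z`-module `M` is self-dual of degree `l`: there is an isomorphism `M{l} ≅ DM` of
graded `Z`-modules. Here `M{l}` has `M_{l + n}` as its component of degree `n`, and `z` in `Z`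
acts on `DM` by `(z.f)(m) = f(z.m)`. -/
def IsSelfDual [Module G.structureAlgebra M] (deg : ℤ → AddSubgroup M) (l : ℤ) : Prop :=
  ∃ Φ : M ≃+ (gradedDual (k := k) (V := V) deg),
    (∀ (n : ℤ) (m : M), m ∈ deg (l + n) ↔ (Φ m).1 ∈ homDeg (k := k) (V := V) deg n) ∧
    ∀ (z : G.structureAlgebra) (m m' : M), (Φ (z • m)).1 m' = (Φ m).1 (z • m')

end Duality

end MomentGraph

end MomentGraphTheory

end

/-! Self-duality gives an isomorphism Φ from B to its dual with Φ(zm)(m') = Φ(m)(zm') for z in the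
structure algebra. It is tested on `G.delta y`, written δ_y: supported at y, with value the product
of all labels at y, hence homogeneous of degree `G.numEdges y`. For a section u of degree 0, the
form F = Φ(u) has degree -l, so F(δ_y u) has degree `G.numEdges y` - l. Both implications rest on
F(δ_y u) being a unit.

(1 ⇒ 2) Stalks are quotients of the global sections, so a generator of B^x lifts to u in degree 0,
and u then freely generates every stalk above x (`isFreeGenerator_of_le`). For y ≥ x, the
coefficient of m_y with respect to u_y is a form of degree 0, hence some Φ(b). This b is supported
at y, and the GKM condition forces b = s δ_y u (`exists_eq_smul_delta`). Evaluation at u gives s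
F(δ_y u) = 1, and a homogeneous unit has degree 0.

(2 ⇒ 1) Let u lift a generator of B^t. For y ≥ x the F(δ_y u) are scalars; descending from t, they
are nonzero and u_y generates B^y. The ends x, y of an edge with label α are linked by a residue
condition: α divides P_y F(δ_x m) + P_x F(δ_y m), where P_x, P_y are the products of the other
labels. Taking m = u gives the nonvanishing. If m is corrected by a multiple of u so that F(δ_x m) =
0, the condition puts m_x in the kernel of `rhoUp`; this kernel is superfluous, so u_x generates. -/

namespace MomentGraphTheory

/-! ### Symmetric algebra: primality of linear forms and degrees of units. -/

section SymmetricAlgebra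

variable {k : Type u} [Field k] {V : Type v} [AddCommGroup V] [Module k V]

/-- Extending a to a basis of V turns S into a polynomial ring in which a is a variable. -/
theorem prime_iota {a : V} (ha : a ≠ 0) : Prime (SymmetricAlgebra.ι k V a) := by
  have hs : LinearIndepOn k id ({a} : Set V) := LinearIndepOn.singleton ha
  let b := Module.Basis.extend hs
  let i : hs.extend (Set.subset_univ _) := ⟨a, hs.subset_extend _ rfl⟩
  have hi : b i = a := Module.Basis.extend_apply_self hs i
  have hX : SymmetricAlgebra.equivMvPolynomial b (SymmetricAlgebra.ι k V a) = .X i :=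
    (congrArg (fun c => SymmetricAlgebra.equivMvPolynomial b (SymmetricAlgebra.ι k V c)) hi).symm.trans
      (SymmetricAlgebra.equivMvPolynomial_ι_apply b i)
  rw [← MulEquiv.prime_iff (SymmetricAlgebra.equivMvPolynomial b), hX]
  exact MvPolynomial.X_prime

/-- A linear form that kills a but not b extends to a point of S where a vanishes and b does not. -/
theorem not_iota_dvd_iota {a b : V} (h : LinearIndependent k ![a, b]) :
    ¬ SymmetricAlgebra.ι k V a ∣ SymmetricAlgebra.ι k V b := by
  have hb : b ∉ Submodule.span k {a} := by
    rw [Submodule.mem_span_singleton]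
    rintro ⟨c, hc⟩
    have := LinearIndependent.pair_iff.mp h c (-1) (by rw [hc]; simp)
    simp at this
  obtain ⟨f, hf, hfa⟩ := Submodule.exists_le_ker_of_notMem hb
  rintro ⟨s, hs⟩
  have h1 := congrArg (SymmetricAlgebra.lift f) hs
  have ha : f a = 0 := hfa (Submodule.mem_span_singleton_self a)
  rw [map_mul, SymmetricAlgebra.lift_ι_apply, SymmetricAlgebra.lift_ι_apply, ha, zero_mul] at h1
  exact hf h1

theorem symDeg_neg {n : ℤ} (hn : n < 0) {s : SymmetricAlgebra k V} (hs : s ∈ symDeg k V n) :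
    s = 0 := by
  obtain ⟨m, rfl⟩ := Int.eq_negSucc_of_lt_zero hn
  exact (Submodule.mem_bot k).mp hs

theorem mem_symDeg_zero {s : SymmetricAlgebra k V} (hs : s ∈ symDeg k V 0) :
    ∃ a : k, s = algebraMap k _ a := by
  change s ∈ LinearMap.range (SymmetricAlgebra.ι k V) ^ 0 at hs
  rw [pow_zero, Submodule.mem_one] at hs
  obtain ⟨a, ha⟩ := hs
  exact ⟨a, ha.symm⟩

theorem isUnit_of_mem_symDeg_zero {s : SymmetricAlgebra k V} (hs : s ∈ symDeg k V 0)
    (h : s ≠ 0) : IsUnit s := by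
  obtain ⟨a, rfl⟩ := mem_symDeg_zero hs
  have ha : a ≠ 0 := by
    rintro rfl
    exact h (map_zero _)
  exact (IsUnit.mk0 a ha).map _

/-- The elements of positive degree vanish at the origin. -/
theorem lift_zero_of_mem_symDeg {n : ℤ} (hn : 0 < n) {s : SymmetricAlgebra k V}
    (hs : s ∈ symDeg k V n) : SymmetricAlgebra.lift (0 : V →ₗ[k] k) s = 0 := by
  obtain ⟨m, rfl⟩ : ∃ m : ℕ, n = ((m + 1 : ℕ) : ℤ) := ⟨(n - 1).toNat, by omega⟩
  change s ∈ LinearMap.range (SymmetricAlgebra.ι k V) ^ (m + 1) at hs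
  rw [pow_succ] at hs
  induction hs using Submodule.mul_induction_on' with
  | mem_mul_mem x hx y hy =>
    obtain ⟨y, rfl⟩ := hy
    rw [map_mul, SymmetricAlgebra.lift_ι_apply, LinearMap.zero_apply, mul_zero]
  | add x hx y hy ihx ihy => rw [map_add, ihx, ihy, add_zero]

/-- Components of negative degree are zero, and those of positive degree vanish at the origin, where
a unit cannot. -/
theorem eq_zero_of_isUnit_of_mem_symDeg {n : ℤ} {s : SymmetricAlgebra k V}
    (hs : s ∈ symDeg k V n) (hu : IsUnit s) : n = 0 := by
  rcases lt_trichotomy n 0 with hn | hn | hn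
  · exact absurd (symDeg_neg hn hs) hu.ne_zero
  · exact hn
  · exact absurd (lift_zero_of_mem_symDeg hn hs)
      (hu.map (SymmetricAlgebra.lift (0 : V →ₗ[k] k))).ne_zero

theorem symDeg_induction {P : SymmetricAlgebra k V → Prop} (h0 : P 0)
    (hadd : ∀ a b, P a → P b → P (a + b)) (hmem : ∀ (n : ℤ) (a), a ∈ symDeg k V n → P a)
    (s : SymmetricAlgebra k V) : P s := by
  induction s using DirectSum.Decomposition.inductionOn (symDeg k V) with
  | zero => exact h0
  | homogeneous m => exact hmem _ _ m.2
  | add a b ha hb => exact hadd a b ha hb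

end SymmetricAlgebra

/-! ### Graded modules: homogeneous components, Nakayama's lemma, free modules of rank one. -/

namespace GrMod

variable {k : Type u} [Field k] {V : Type v} [AddCommGroup V] [Module k V] (M : GrMod k V)

noncomputable instance : DirectSum.Decomposition M.deg :=
  M.isInternal.chooseDecomposition

/-- The homogeneous component of degree `i` of an element of `M`. -/
noncomputable def proj (i : ℤ) : M →+ M where
  toFun m := (DirectSum.decompose M.deg m i : M)
  map_zero' := by simp
  map_add' := by simp

variable {M}

theorem proj_mem (i : ℤ) (m : M) : M.proj i m ∈ M.deg i :=
  (DirectSum.decompose M.deg m i).2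

theorem proj_of_mem {i : ℤ} {m : M} (h : m ∈ M.deg i) : M.proj i m = m :=
  DirectSum.decompose_of_mem_same _ h

theorem proj_of_mem_ne {i j : ℤ} {m : M} (h : m ∈ M.deg j) (hij : j ≠ i) : M.proj i m = 0 :=
  DirectSum.decompose_of_mem_ne _ h hij

theorem homogeneous_induction {P : M → Prop} (h0 : P 0)
    (hadd : ∀ a b, P a → P b → P (a + b)) (hmem : ∀ (n : ℤ) (a), a ∈ M.deg n → P a)
    (m : M) : P m := by
  induction m using DirectSum.Decomposition.inductionOn M.deg with
  | zero => exact h0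
  | homogeneous m => exact hmem _ _ m.2
  | add a b ha hb => exact hadd a b ha hb

theorem proj_smul {n : ℤ} {s : SymmetricAlgebra k V} (hs : s ∈ symDeg k V n) (i : ℤ) (m : M) :
    M.proj i (s • m) = s • M.proj (i - n) m := by
  induction m using homogeneous_induction with
  | h0 => simp
  | hadd a b ha hb => simp only [smul_add, map_add, ha, hb]
  | hmem j a ha =>
    have hsa := M.smul_mem n j s a hs ha
    by_cases h : j = i - n
    · subst h
      rw [proj_of_mem ha, proj_of_mem]
      convert! hsa using 2
      ring
    · rw [proj_of_mem_ne ha h, proj_of_mem_ne hsa (by omega), smul_zero]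

theorem smul_proj {d : ℤ} {m : M} (hm : m ∈ M.deg d) (i : ℤ) (s : SymmetricAlgebra k V) :
    M.proj i (s • m) = GradedRing.proj (symDeg k V) (i - d) s • m := by
  induction s using symDeg_induction with
  | h0 => rw [zero_smul, map_zero, map_zero, zero_smul]
  | hadd a b ha hb => rw [add_smul, map_add, ha, hb, ← add_smul, map_add]
  | hmem n a ha =>
    have hsa := M.smul_mem n d a m ha hm
    by_cases h : n = i - d
    · subst h
      rw [GradedRing.proj_apply, DirectSum.decompose_of_mem_same _ ha, proj_of_mem]
      convert! hsa using 2
      ring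
    · rw [GradedRing.proj_apply, DirectSum.decompose_of_mem_ne _ ha h,
        proj_of_mem_ne hsa (by omega), zero_smul]

theorem IsGradedHom.map_proj {N : GrMod k V} {f : M →ₗ[SymmetricAlgebra k V] N}
    (hf : IsGradedHom f) (i : ℤ) (m : M) : f (M.proj i m) = N.proj i (f m) := by
  induction m using homogeneous_induction with
  | h0 => simp
  | hadd a b ha hb => simp only [map_add, ha, hb]
  | hmem j a ha =>
    by_cases h : j = i
    · subst h
      rw [proj_of_mem ha, proj_of_mem (hf _ _ ha)]
    · rw [proj_of_mem_ne ha h, proj_of_mem_ne (hf _ _ ha) h, map_zero]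

theorem isHomogeneous_span_singleton {d : ℤ} {m : M} (hm : m ∈ M.deg d) :
    IsHomogeneous (Submodule.span (SymmetricAlgebra k V) {m}) :=
  Submodule.span_mono (Set.singleton_subset_iff.mpr
    ⟨Submodule.mem_span_singleton_self m, d, hm⟩)

/-- A finitely generated graded module is bounded below. -/
theorem exists_proj_eq_zero (M : GrMod k V) [Module.Finite (SymmetricAlgebra k V) M] :
    ∃ b : ℤ, ∀ i < b, ∀ m : M, M.proj i m = 0 := by
  obtain ⟨T, hT⟩ := Module.Finite.fg_top (R := SymmetricAlgebra k V) (M := M)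
  have hfin : ∀ m : M, ∃ b : ℤ, ∀ i < b, M.proj i m = 0 := by
    intro m
    induction m using homogeneous_induction with
    | h0 => exact ⟨0, fun _ _ => map_zero _⟩
    | hadd a b ha hb =>
      obtain ⟨p, hp⟩ := ha
      obtain ⟨q, hq⟩ := hb
      refine ⟨min p q, fun i hi => ?_⟩
      rw [map_add, hp i (by omega), hq i (by omega), add_zero]
    | hmem j a ha => exact ⟨j, fun i hi => proj_of_mem_ne ha hi.ne'⟩
  choose b hb using hfin
  obtain ⟨c, hc⟩ := (T.image b).bddBelow
  refine ⟨c, fun i hi m => ?_⟩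
  have hm : m ∈ Submodule.span (SymmetricAlgebra k V) (T : Set M) := hT ▸ Submodule.mem_top
  induction hm using Submodule.span_induction generalizing i with
  | mem x hx =>
    exact hb x i (hi.trans_le (hc (Finset.mem_coe.mpr (Finset.mem_image_of_mem b hx))))
  | zero => exact map_zero _
  | add x y _ _ hx hy => rw [map_add, hx i hi, hy i hi, add_zero]
  | smul s x _ hx =>
    -- Since S has no negative degrees, scalars only raise degrees, and a bound for the generators
    -- holds throughout.
    induction s using symDeg_induction with
    | h0 => rw [zero_smul, map_zero]
    | hadd a b ha hb => rw [add_smul, map_add, ha, hb, add_zero]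
    | hmem n a ha =>
      rcases lt_or_ge n 0 with hn | hn
      · rw [symDeg_neg hn ha, zero_smul, map_zero]
      · rw [proj_smul ha, hx _ (by omega), smul_zero]

/-- Nakayama's lemma for a homogeneous generator, modulo an element of degree one. -/
theorem span_singleton_eq_top_of_sup_smul [Module.Finite (SymmetricAlgebra k V) M] {d : ℤ}
    {e : M} (he : e ∈ M.deg d) {a : SymmetricAlgebra k V} (ha : a ∈ symDeg k V 1)
    (h : ∀ m : M, ∃ (s : SymmetricAlgebra k V) (m' : M), m = s • e + a • m') (m : M) :
    ∃ s : SymmetricAlgebra k V, m = s • e := by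
  obtain ⟨b, hb⟩ := M.exists_proj_eq_zero
  -- Induction on the degree, starting at b - 1 where all components vanish; the correction a • m'
  -- involves m' only in the degree one lower.
  have key : ∀ (n : ℕ) (m : M), ∃ s : SymmetricAlgebra k V, M.proj (b + n - 1) m = s • e := by
    intro n
    induction n with
    | zero => exact fun m => ⟨0, by rw [hb _ (by simp), zero_smul]⟩
    | succ n ih =>
      intro m
      obtain ⟨s, m', rfl⟩ := h m
      obtain ⟨s', hs'⟩ := ih m'
      refine ⟨GradedRing.proj (symDeg k V) (b + (n + 1 : ℕ) - 1 - d) s + a * s', ?_⟩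
      rw [map_add, smul_proj he, proj_smul ha]
      have : b + ((n + 1 : ℕ) : ℤ) - 1 - 1 = b + n - 1 := by push_cast; ring
      rw [this, hs', smul_smul]
      rw [add_smul]
  induction m using homogeneous_induction with
  | h0 => exact ⟨0, (zero_smul _ _).symm⟩
  | hadd x y hx hy =>
    obtain ⟨s, rfl⟩ := hx
    obtain ⟨s', rfl⟩ := hy
    exact ⟨s + s', (add_smul _ _ _).symm⟩
  | hmem j x hx =>
    rcases lt_or_ge j b with hj | hj
    · exact ⟨0, by rw [← proj_of_mem hx, hb j hj, zero_smul]⟩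
    · obtain ⟨s, hs⟩ := key (j - b + 1).toNat x
      refine ⟨s, ?_⟩
      rw [← hs, Int.toNat_of_nonneg (by omega)]
      have : b + (j - b + 1) - 1 = j := by ring
      rw [this, proj_of_mem hx]

/-- `e` has degree zero, is nonzero and generates `M`. If `M` is torsion free, then it is free on `e`. -/
structure IsFreeGenerator (e : M) : Prop where
  mem : e ∈ M.deg 0
  ne_zero : e ≠ 0
  span : ∀ m : M, ∃ s : SymmetricAlgebra k V, m = s • e

theorem smul_eq_zero_imp [Module.IsTorsionFree (SymmetricAlgebra k V) M]
    {s : SymmetricAlgebra k V} {m : M} (h : s • m = 0) (hm : m ≠ 0) : s = 0 :=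
  (smul_eq_zero.mp h).resolve_right hm

/-- As e has degree 0, the i-th component of s • e is the i-th component of s times e; torsion
freeness cancels e. -/
theorem smul_mem_deg_iff [Module.IsTorsionFree (SymmetricAlgebra k V) M] {e : M}
    (he : e ∈ M.deg 0) (h0 : e ≠ 0) {i : ℤ} {s : SymmetricAlgebra k V} :
    s • e ∈ M.deg i ↔ s ∈ symDeg k V i := by
  constructor
  · intro h
    have h1 := smul_proj he i s
    rw [proj_of_mem h, sub_zero] at h1
    have h2 : (s - GradedRing.proj (symDeg k V) i s) • e = 0 := by
      rw [sub_smul, ← h1, sub_self]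
    rw [sub_eq_zero.mp (smul_eq_zero_imp h2 h0)]
    exact (DirectSum.decompose (symDeg k V) s i).2
  · intro h
    simpa using M.smul_mem i 0 s e h he

theorem isIso_ring_iff [Module.IsTorsionFree (SymmetricAlgebra k V) M] :
    M.IsIso (GrMod.ring k V) ↔ ∃ e : M, IsFreeGenerator e := by
  constructor
  · rintro ⟨φ, hφ⟩
    let f : M ≃ₗ[SymmetricAlgebra k V] SymmetricAlgebra k V := φ
    refine ⟨f.symm 1, ?_, ?_, fun m => ⟨f m, ?_⟩⟩
    · rw [hφ]
      change f (f.symm 1) ∈ symDeg k V 0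
      rw [f.apply_symm_apply]
      exact SetLike.GradedOne.one_mem
    · simp
    · apply f.injective
      rw [map_smul, f.apply_symm_apply, smul_eq_mul, mul_one]
  · rintro ⟨e, h⟩
    have hbij : Function.Bijective (LinearMap.toSpanSingleton (SymmetricAlgebra k V) M e) := by
      constructor
      · rw [injective_iff_map_eq_zero]
        exact fun s hs => smul_eq_zero_imp hs h.ne_zero
      · intro m
        obtain ⟨s, rfl⟩ := h.span m
        exact ⟨s, rfl⟩
    let f := LinearEquiv.ofBijective _ hbij
    refine ⟨f.symm, fun i m => ?_⟩
    obtain ⟨s, rfl⟩ := f.surjective m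
    change f s ∈ M.deg i ↔ f.symm (f s) ∈ symDeg k V i
    rw [f.symm_apply_apply]
    exact smul_mem_deg_iff h.mem h.ne_zero

end GrMod

end MomentGraphTheory

namespace MomentGraphTheory

namespace MomentGraph

variable {k : Type u} [Field k] {V : Type v} [AddCommGroup V] [Module k V]
  {ι : Type w} [PartialOrder ι] {G : MomentGraph k V ι}

theorem exists_adj_lt {x y : ι} (h : x ≤ y) (hne : x ≠ y) :
    ∃ z, G.graph.Adj x z ∧ x < z := by
  rcases (G.generated x y h).cases_head with rfl | ⟨z, hz, -⟩
  · exact absurd rfl hne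
  · exact ⟨z, hz⟩

/-! ### Extension of sections of a Braden-MacPherson sheaf. -/

namespace Sheaf

variable (M : G.Sheaf)

/-- The edges built from (x, y) and from (y, x) are equal but not definitionally; stating this for
arbitrary e = f makes substitution possible. -/
theorem rho_eq_congr {x y : ι} (a : M.stalk x) (b : M.stalk y) {e f : G.graph.edgeSet}
    (hef : e = f) (hx : x ∈ (e : Sym2 ι)) (hy : y ∈ (e : Sym2 ι)) (hx' : x ∈ (f : Sym2 ι))
    (hy' : y ∈ (f : Sym2 ι)) (h : M.rho x e hx a = M.rho y e hy b) :
    M.rho y f hy' b = M.rho x f hx' a := by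
  subst hef
  exact h.symm

theorem resL_eq_resR_symm {x y : ι} (h : G.graph.Adj x y) {a : M.stalk x} {b : M.stalk y}
    (hab : M.resL h a = M.resR h b) : M.resL h.symm b = M.resR h.symm a :=
  M.rho_eq_congr a b (Subtype.ext Sym2.eq_swap) _ _ _ _ hab

/-- A family of elements of the stalks that restricts to a section over `Λ`. -/
def IsSectionOn (Λ : Set ι) (m : ∀ x, M.stalk x) : Prop :=
  ∀ (x y : ι), x ∈ Λ → y ∈ Λ → ∀ h : G.graph.Adj x y, M.resL h (m x) = M.resR h (m y)

variable {M}

open Classical in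
theorem IsSectionOn.insert {Λ : Set ι} {m : ∀ x, M.stalk x} (hm : M.IsSectionOn Λ m) {x : ι}
    (hx : x ∉ Λ) {a : M.stalk x}
    (ha : ∀ (y : ι) (h : G.graph.Adj x y), y ∈ Λ → M.resL h a = M.resR h (m y)) :
    M.IsSectionOn (insert x Λ) (Function.update m x a) := by
  have hne : ∀ {y}, y ∈ Λ → y ≠ x := fun hy h => hx (h ▸ hy)
  intro y z hy hz h
  rcases Set.mem_insert_iff.mp hy with rfl | hyΛ <;> rcases Set.mem_insert_iff.mp hz with rfl | hzΛ
  · exact absurd rfl h.ne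
  · rw [Function.update_self, Function.update_of_ne (hne hzΛ)]
    exact ha z h hzΛ
  · rw [Function.update_self, Function.update_of_ne (hne hyΛ)]
    exact M.resL_eq_resR_symm h.symm (ha y h.symm hyΛ)
  · rw [Function.update_of_ne (hne hyΛ), Function.update_of_ne (hne hzΛ)]
    exact hm y z hyΛ hzΛ h

variable {t : ι}

/-- The values on the edges going up from x form an element of `upImage x`, which is the image of
the stalk. As Λ is an upper set avoiding x, no neighbour of x in Λ lies below x. -/
theorem IsBradenMacPherson.exists_extend_insert (hM : M.IsBradenMacPherson t) {Λ : Set ι}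
    (hΛ : IsUpperSet Λ) {m : ∀ x, M.stalk x} (hm : M.IsSectionOn Λ m) {x : ι} (hxt : x ≠ t)
    (hx : x ∉ Λ) (hxΛ : Set.Ioi x ⊆ Λ) :
    ∃ m', M.IsSectionOn (insert x Λ) m' ∧ ∀ y ∈ Λ, m' y = m y := by
  classical
  have hmem : (fun y : M.Up x => M.resR y.2.1 (m y.1)) ∈ M.upImage x :=
    ⟨fun y => m y.1, fun y z h => hm y z (hxΛ y.2) (hxΛ z.2) h, rfl⟩
  rw [← hM.range_rhoUp x hxt] at hmem
  obtain ⟨a, ha⟩ := hmem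
  refine ⟨Function.update m x a, hm.insert hx fun y h hy => ?_, fun y hy => ?_⟩
  · have hlt : x < y := (G.comparable x y h).resolve_right fun hyx => hx (hΛ hyx.le hy)
    exact congrFun ha ⟨y, h, hlt⟩
  · exact Function.update_of_ne (ne_of_mem_of_not_mem hy hx) _ _

/-- Flabbiness: maximal vertices of the complement are added one at a time. Having t in Λ keeps each
new vertex different from t, as the condition on `rhoUp` requires. -/
theorem IsBradenMacPherson.exists_extend [Finite ι] (hM : M.IsBradenMacPherson t) {Λ : Set ι}
    (hΛ : IsUpperSet Λ) (htΛ : t ∈ Λ) {m : ∀ x, M.stalk x} (hm : M.IsSectionOn Λ m) :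
    ∃ m' : M.sections, ∀ y ∈ Λ, m'.1 y = m y := by
  induction Λ using WellFoundedGT.induction generalizing m with
  | ind Λ ih =>
    by_cases hne : Λᶜ = ∅
    · have huniv : ∀ y, y ∈ Λ := fun y => by_contra fun hy => hne.subset hy
      exact ⟨⟨m, fun x y h => hm x y (huniv x) (huniv y) h⟩, fun _ _ => rfl⟩
    · obtain ⟨x, hx⟩ := (Set.toFinite Λᶜ).exists_maximal (Set.nonempty_iff_ne_empty.mpr hne)
      have hxΛ : x ∉ Λ := hx.prop
      have hIoi : Set.Ioi x ⊆ Λ := fun y hy => by_contra fun hyΛ => hx.not_gt hyΛ hy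
      obtain ⟨m₁, hm₁, hm₁'⟩ := hM.exists_extend_insert hΛ hm (ne_of_mem_of_not_mem htΛ hxΛ).symm hxΛ hIoi
      have hup : IsUpperSet (insert x Λ) := by
        rintro a b hab (rfl | ha)
        · exact hab.eq_or_lt.elim (fun h => Or.inl h.symm) fun h => Or.inr (hIoi h)
        · exact Or.inr (hΛ hab ha)
      obtain ⟨m', hm'⟩ := ih (insert x Λ) (Set.ssubset_insert hxΛ) hup (Or.inr htΛ) hm₁
      exact ⟨m', fun y hy => (hm' y (Or.inr hy)).trans (hm₁' y hy)⟩

/-- The stalks of a Braden-MacPherson sheaf are quotients of the module of global sections. -/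
theorem IsBradenMacPherson.exists_section [Finite ι] (hM : M.IsBradenMacPherson t)
    (ht : ∀ y, y ≤ t) (x : ι) (a : M.stalk x) : ∃ m : M.sections, m.1 x = a := by
  classical
  obtain ⟨m₀, hm₀, ha⟩ : ∃ m₀ : ∀ y, M.stalk y, M.IsSectionOn (Set.Ioi x) m₀ ∧
      ∀ (y : ι) (h : G.graph.Adj x y), y ∈ Set.Ioi x → M.resL h a = M.resR h (m₀ y) := by
    by_cases hxt : x = t
    · have hno : ∀ y, y ∉ Set.Ioi x := fun y hy => (ht y).not_gt (hxt ▸ hy)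
      exact ⟨0, fun y _ hy => absurd hy (hno y), fun y _ hy => absurd hy (hno y)⟩
    · have hmem : M.rhoUp x a ∈ M.upImage x := hM.range_rhoUp x hxt ▸ LinearMap.mem_range_self _ a
      obtain ⟨m₁, hm₁, heq⟩ := hmem
      refine ⟨fun y => if h : y ∈ Set.Ioi x then m₁ ⟨y, h⟩ else 0, fun y z hy hz h => ?_,
        fun y h hy => ?_⟩
      · simp only [dif_pos hy, dif_pos hz]
        exact hm₁ ⟨y, hy⟩ ⟨z, hz⟩ h
      · simp only [dif_pos hy]
        exact (congrFun heq ⟨y, h, hy⟩).symm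
  have hs := hm₀.insert (Set.self_notMem_Ioi) ha
  rw [Set.insert_eq, Set.union_comm, Set.Ioi_union_left] at hs
  obtain ⟨m, hm⟩ := hM.exists_extend (isUpperSet_Ici x) (ht x) hs
  exact ⟨m, (hm x Set.self_mem_Ici).trans (Function.update_self _ _ _)⟩

theorem IsBradenMacPherson.exists_section_of_mem_deg [Finite ι] (hM : M.IsBradenMacPherson t)
    (ht : ∀ y, y ≤ t) {x : ι} {i : ℤ} {a : M.stalk x} (ha : a ∈ (M.stalk x).deg i) :
    ∃ m ∈ M.sectionsDeg i, m.1 x = a := by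
  obtain ⟨m, hm⟩ := hM.exists_section ht x a
  refine ⟨⟨fun y => (M.stalk y).proj i (m.1 y), fun y z h => ?_⟩,
    fun y => GrMod.proj_mem _ _, ?_⟩
  · rw [GrMod.IsGradedHom.map_proj (M.rho_graded _ _ _),
      GrMod.IsGradedHom.map_proj (M.rho_graded _ _ _), m.2 y z h]
  · change (M.stalk x).proj i (m.1 x) = a
    rw [hm, GrMod.proj_of_mem ha]

end Sheaf

/-! ### Products of labels -/

theorem prime_labelS (e : G.graph.edgeSet) : Prime (G.labelS e) :=
  prime_iota (G.label_ne_zero e)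

theorem IsGKM.not_dvd (hG : G.IsGKM) {x : ι} {e f : G.graph.edgeSet} (hef : e ≠ f)
    (he : x ∈ (e : Sym2 ι)) (hf : x ∈ (f : Sym2 ι)) : ¬ G.labelS e ∣ G.labelS f :=
  not_iota_dvd_iota (hG x e f hef he hf)

variable [Finite ι]

variable (G) in
/-- The edges that contain `x`. -/
noncomputable def edgesAt (x : ι) : Finset G.graph.edgeSet :=
  (Set.toFinite {e : G.graph.edgeSet | x ∈ (e : Sym2 ι)}).toFinset

theorem mem_edgesAt {x : ι} {e : G.graph.edgeSet} : e ∈ G.edgesAt x ↔ x ∈ (e : Sym2 ι) := by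
  simp [edgesAt]

variable (G) in
/-- The product of the labels of the edges at `x`. -/
noncomputable def labelProd (x : ι) : SymmetricAlgebra k V := ∏ e ∈ G.edgesAt x, G.labelS e

open Classical in
variable (G) in
/-- The product of the labels of the edges at `x` that are different from `e`. -/
noncomputable def labelProdErase (x : ι) (e : G.graph.edgeSet) : SymmetricAlgebra k V :=
  ∏ f ∈ (G.edgesAt x).erase e, G.labelS f

theorem labelS_mul_labelProdErase {x : ι} {e : G.graph.edgeSet} (he : x ∈ (e : Sym2 ι)) :
    G.labelS e * G.labelProdErase x e = G.labelProd x := by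
  classical
  exact Finset.mul_prod_erase _ _ (mem_edgesAt.mpr he)

theorem labelS_dvd_labelProd {x : ι} {e : G.graph.edgeSet} (he : x ∈ (e : Sym2 ι)) :
    G.labelS e ∣ G.labelProd x :=
  Finset.dvd_prod_of_mem _ (mem_edgesAt.mpr he)

theorem labelS_dvd_labelProdErase {x : ι} {e f : G.graph.edgeSet} (hf : x ∈ (f : Sym2 ι))
    (hfe : f ≠ e) : G.labelS f ∣ G.labelProdErase x e := by
  classical
  exact Finset.dvd_prod_of_mem _ (Finset.mem_erase.mpr ⟨hfe, mem_edgesAt.mpr hf⟩)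

theorem IsGKM.not_dvd_labelProdErase (hG : G.IsGKM) {x : ι} {e : G.graph.edgeSet}
    (he : x ∈ (e : Sym2 ι)) : ¬ G.labelS e ∣ G.labelProdErase x e := by
  classical
  intro h
  obtain ⟨f, hf, hdvd⟩ := (prime_labelS e).exists_mem_finset_dvd h
  obtain ⟨hfe, hf⟩ := Finset.mem_erase.mp hf
  exact hG.not_dvd hfe.symm he (mem_edgesAt.mp hf) hdvd

theorem labelProd_ne_zero (x : ι) : G.labelProd x ≠ 0 :=
  Finset.prod_ne_zero_iff.mpr fun e _ => (prime_labelS e).ne_zero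

theorem labelProd_mem (x : ι) : G.labelProd x ∈ symDeg k V (G.numEdges x) := by
  have h := SetLike.prod_mem_graded (symDeg k V) (F := G.edgesAt x) (i := fun _ => 1) (g := G.labelS)
    fun e _ => iota_mem_symDeg k V (G.label e)
  have hcard : G.numEdges x = (G.edgesAt x).card := Set.ncard_eq_toFinset_card _ (Set.toFinite _)
  rw [hcard, labelProd]
  simpa using h

/-- By the GKM condition the labels at x are primes none of which divides another. -/
theorem IsGKM.labelProd_dvd (hG : G.IsGKM) {x : ι} {s : SymmetricAlgebra k V}
    (h : ∀ e : G.graph.edgeSet, x ∈ (e : Sym2 ι) → G.labelS e ∣ s) : G.labelProd x ∣ s := by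
  classical
  suffices ∀ T ⊆ G.edgesAt x, ∏ e ∈ T, G.labelS e ∣ s from this _ subset_rfl
  intro T
  induction T using Finset.induction_on with
  | empty => exact fun _ => by simp
  | insert e T he ih =>
    intro hT
    obtain ⟨heT, hT⟩ := Finset.insert_subset_iff.mp hT
    obtain ⟨s', hs'⟩ := ih hT
    have hdvd := h e (mem_edgesAt.mp heT)
    rw [hs'] at hdvd
    rcases (prime_labelS e).dvd_or_dvd hdvd with hd | ⟨s'', rfl⟩
    · obtain ⟨f, hf, hd⟩ := (prime_labelS e).exists_mem_finset_dvd hd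
      exact absurd hd (hG.not_dvd (fun hef => he (hef ▸ hf)) (mem_edgesAt.mp heT)
        (mem_edgesAt.mp (hT hf)))
    · exact ⟨s'', by rw [hs', Finset.prod_insert he]; ring⟩

open Classical in
variable (G) in
/-- The element of the structure algebra that is supported at `x` and has the product of all
labels at `x` as its value there. -/
noncomputable def delta (x : ι) : G.structureAlgebra where
  val := Pi.single x (G.labelProd x)
  property := by
    intro a b h
    by_cases ha : a = x
    · subst ha
      rw [Pi.single_eq_same, Pi.single_eq_of_ne h.ne', sub_zero]
      exact labelS_dvd_labelProd (Sym2.mem_mk_left _ _)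
    · by_cases hb : b = x
      · subst hb
        rw [Pi.single_eq_same, Pi.single_eq_of_ne h.ne, zero_sub, dvd_neg]
        exact labelS_dvd_labelProd (Sym2.mem_mk_right _ _)
      · rw [Pi.single_eq_of_ne ha, Pi.single_eq_of_ne hb, sub_zero]
        exact dvd_zero _

theorem delta_self (x : ι) : (G.delta x).1 x = G.labelProd x := by
  classical
  exact Pi.single_eq_same (M := fun _ => SymmetricAlgebra k V) x (G.labelProd x)

theorem delta_of_ne {x y : ι} (h : y ≠ x) : (G.delta x).1 y = 0 := by
  classical
  exact Pi.single_eq_of_ne (M := fun _ => SymmetricAlgebra k V) h (G.labelProd x)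

open Classical in
variable (G) in
/-- The element of the structure algebra that is supported on the edge through `x` and `y`, with
the product of the labels of all other edges at `x` and at `y` as its value at both vertices. -/
noncomputable def edgeDelta {x y : ι} (h : G.graph.Adj x y) : G.structureAlgebra where
  val a := if a = x ∨ a = y then
    G.labelProdErase x (G.edge h) * G.labelProdErase y (G.edge h) else 0
  property := by
    have key : ∀ (a : ι) (f : G.graph.edgeSet), (a = x ∨ a = y) → a ∈ (f : Sym2 ι) →
        f ≠ G.edge h → G.labelS f ∣
          G.labelProdErase x (G.edge h) * G.labelProdErase y (G.edge h) := by
      rintro a f (rfl | rfl) haf hf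
      · exact (labelS_dvd_labelProdErase haf hf).mul_right _
      · exact (labelS_dvd_labelProdErase haf hf).mul_left _
    have hne : ∀ (b : ι) (f : G.graph.edgeSet), b ∈ (f : Sym2 ι) → ¬ (b = x ∨ b = y) →
        f ≠ G.edge h := by
      rintro b f hbf hb rfl
      exact hb (Sym2.mem_iff.mp hbf)
    intro a b hab
    have hl : a ∈ (G.edge hab : Sym2 ι) := Sym2.mem_mk_left _ _
    have hr : b ∈ (G.edge hab : Sym2 ι) := Sym2.mem_mk_right _ _
    by_cases ha : a = x ∨ a = y <;> by_cases hb : b = x ∨ b = y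
    · simp only [if_pos ha, if_pos hb, sub_self]
      exact dvd_zero _
    · simp only [if_pos ha, if_neg hb, sub_zero]
      exact key a _ ha hl (hne b _ hr hb)
    · simp only [if_neg ha, if_pos hb, zero_sub, dvd_neg]
      exact key b _ hb hr (hne a _ hl ha)
    · simp only [if_neg ha, if_neg hb, sub_zero]
      exact dvd_zero _

/-- The missing label completes the product at either end. This relation is the source of the
residue condition. -/
theorem labelS_smul_edgeDelta {x y : ι} (h : G.graph.Adj x y) :
    G.labelS (G.edge h) • G.edgeDelta h =
      G.labelProdErase y (G.edge h) • G.delta x + G.labelProdErase x (G.edge h) • G.delta y := by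
  have hx := labelS_mul_labelProdErase (G := G) (e := G.edge h) (Sym2.mem_mk_left x y)
  have hy := labelS_mul_labelProdErase (G := G) (e := G.edge h) (Sym2.mem_mk_right x y)
  classical
  apply Subtype.ext
  funext a
  change G.labelS (G.edge h) * (if a = x ∨ a = y then _ else 0) =
    G.labelProdErase y (G.edge h) * (G.delta x).1 a +
      G.labelProdErase x (G.edge h) * (G.delta y).1 a
  by_cases hax : a = x
  · subst hax
    rw [if_pos (Or.inl rfl), delta_self, delta_of_ne h.ne, ← hx]
    ring
  · by_cases hay : a = y
    · subst hay
      rw [if_pos (Or.inr rfl), delta_self, delta_of_ne hax, ← hy]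
      ring
    · rw [if_neg (by tauto), delta_of_ne hax, delta_of_ne hay]
      ring

end MomentGraph

end MomentGraphTheory

namespace MomentGraphTheory

namespace MomentGraph

variable {k : Type u} [Field k] {V : Type v} [AddCommGroup V] [Module k V]
  {ι : Type w} [PartialOrder ι] {G : MomentGraph k V ι}

/-! ### Free generators of stalks, and linear forms on the global sections. -/

namespace Sheaf

variable {M : G.Sheaf}

instance : SMul G.structureAlgebra M.sections :=
  (inferInstance : Module G.structureAlgebra M.sections).toSMul

theorem smul_val (z : G.structureAlgebra) (m : M.sections) (x : ι) :
    (z • m).1 x = z.1 x • m.1 x := rfl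

instance (x : ι) : Module.Finite (SymmetricAlgebra k V) (M.stalk x) := M.stalk_finite x

instance (x : ι) : Module.IsTorsionFree (SymmetricAlgebra k V) (M.stalk x) :=
  M.stalk_torsionFree x

instance : IsScalarTower (SymmetricAlgebra k V) G.structureAlgebra M.sections where
  smul_assoc s z m := Subtype.ext (funext fun x => mul_smul s (z.1 x) (m.1 x))

theorem smul_smul_comm (s : SymmetricAlgebra k V) (z : G.structureAlgebra) (m : M.sections) :
    z • (s • m) = s • (z • m) :=
  Subtype.ext (funext fun x => smul_comm (z.1 x) s (m.1 x))

section FreeGenerators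

variable {t : ι}

theorem IsBradenMacPherson.resR_smul_eq_zero_imp (hM : M.IsBradenMacPherson t) {x y : ι}
    (h : G.graph.Adj x y) (hxy : x < y) {e : M.stalk y} (he : GrMod.IsFreeGenerator e)
    {s : SymmetricAlgebra k V} (hs : M.resR h (s • e) = 0) : G.labelS (G.edge h) ∣ s := by
  obtain ⟨m, hm⟩ := (hM.ker x y h hxy _).mp hs
  obtain ⟨s', rfl⟩ := he.span m
  have h0 : (s - G.labelS (G.edge h) * s') • e = 0 := by
    rw [sub_smul, mul_smul, ← hm, sub_self]
  exact ⟨s', sub_eq_zero.mp (GrMod.smul_eq_zero_imp h0 he.ne_zero)⟩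

/-- Lift b to a section m with m_x = s u_x. Then m_y - s u_y dies on the edge, so lies in αB^y, and
graded Nakayama applies. -/
theorem IsBradenMacPherson.span_of_adj [Finite ι] (hM : M.IsBradenMacPherson t)
    (ht : ∀ y, y ≤ t) {x y : ι} (h : G.graph.Adj x y) (hxy : x < y) {u : M.sections}
    (hu : u ∈ M.sectionsDeg 0) (hx : ∀ a : M.stalk x, ∃ s : SymmetricAlgebra k V, a = s • u.1 x)
    (b : M.stalk y) : ∃ s : SymmetricAlgebra k V, b = s • u.1 y := by
  refine GrMod.span_singleton_eq_top_of_sup_smul (hu y)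
    (iota_mem_symDeg k V (G.label (G.edge h))) (fun c => ?_) b
  obtain ⟨m, rfl⟩ := hM.exists_section ht y c
  obtain ⟨s, hs⟩ := hx (m.1 x)
  have h0 : M.resR h (m.1 y - s • u.1 y) = 0 := by
    rw [map_sub, map_smul, ← m.2 x y h, ← u.2 x y h, hs, map_smul, sub_self]
  obtain ⟨m', hm'⟩ := (hM.ker x y h hxy _).mp h0
  exact ⟨s, m', by rw [← sub_eq_iff_eq_add']; exact hm'⟩

/-- If u_x = 0, then u_y lies in αB^y = αS u_y, which would make the label α a unit. -/
theorem IsBradenMacPherson.ne_zero_of_adj (hM : M.IsBradenMacPherson t) {x y : ι}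
    (h : G.graph.Adj x y) (hxy : x < y) {u : M.sections}
    (hy : ∀ b : M.stalk y, ∃ s : SymmetricAlgebra k V, b = s • u.1 y) (hu : u.1 y ≠ 0) :
    u.1 x ≠ 0 := by
  intro h0
  have h1 : M.resR h (u.1 y) = 0 := by rw [← u.2 x y h, h0, map_zero]
  obtain ⟨m, hm⟩ := (hM.ker x y h hxy _).mp h1
  obtain ⟨s, rfl⟩ := hy m
  have h2 : (1 - G.labelS (G.edge h) * s) • u.1 y = 0 := by
    rw [sub_smul, one_smul, mul_smul, ← hm, sub_self]
  exact (prime_labelS (G.edge h)).not_isUnit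
    (IsUnit.of_mul_eq_one _ (sub_eq_zero.mp (GrMod.smul_eq_zero_imp h2 hu)).symm)

/-- If a section generates the stalk at `x` freely, it does so at all vertices above `x`. -/
theorem IsBradenMacPherson.isFreeGenerator_of_le [Finite ι] (hM : M.IsBradenMacPherson t)
    (ht : ∀ y, y ≤ t) {x y : ι} (hxy : x ≤ y) {u : M.sections} (hu : u ∈ M.sectionsDeg 0)
    (hx : GrMod.IsFreeGenerator (u.1 x)) : GrMod.IsFreeGenerator (u.1 y) := by
  have hspan : ∀ y, x ≤ y → ∀ b : M.stalk y, ∃ s : SymmetricAlgebra k V, b = s • u.1 y := by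
    intro y hxy
    induction G.generated x y hxy with
    | refl => exact hx.span
    | tail hab hbc ih =>
      have hle : ∀ {a b : ι}, Relation.ReflTransGen (fun a b => G.graph.Adj a b ∧ a < b) a b →
          a ≤ b := fun h => by
        induction h with
        | refl => exact le_rfl
        | tail _ h ih => exact ih.trans h.2.le
      exact hM.span_of_adj ht hbc.1 hbc.2 hu (ih (hle hab))
  -- Generation spreads upwards from x, but nonvanishing comes down from t, where it holds because
  -- B^t is nonzero.
  have hne : u.1 y ≠ 0 := by
    induction y using WellFoundedGT.induction with
    | ind y ih =>
      by_cases hyt : y = t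
      · subst hyt
        intro h0
        obtain ⟨e, he⟩ := GrMod.isIso_ring_iff.mp hM.top
        obtain ⟨s, hs⟩ := hspan y hxy e
        exact he.ne_zero (by rw [hs, h0, smul_zero])
      · obtain ⟨z, hz, hyz⟩ := G.exists_adj_lt (ht y) hyt
        have hxz := hxy.trans hyz.le
        exact hM.ne_zero_of_adj hz hyz (hspan z hxz) (ih z hyz hxz)
  exact ⟨hu y, hne, hspan y hxy⟩

end FreeGenerators

/-- The coefficient with respect to a free generator, as a linear form of degree zero. -/
theorem exists_coeff {y : ι} {e : M.stalk y} (he : GrMod.IsFreeGenerator e) :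
    ∃ g : M.sections →ₗ[SymmetricAlgebra k V] SymmetricAlgebra k V,
      (∀ m, m.1 y = g m • e) ∧ g ∈ homDeg (k := k) (V := V) M.sectionsDeg 0 := by
  choose c hc using he.span
  have huniq : ∀ {s s' : SymmetricAlgebra k V}, s • e = s' • e → s = s' := fun {s s'} h =>
    sub_eq_zero.mp (GrMod.smul_eq_zero_imp (by rw [sub_smul, h, sub_self]) he.ne_zero)
  refine ⟨{ toFun := fun m => c (m.1 y), map_add' := fun m m' => huniq ?_,
            map_smul' := fun s m => huniq ?_ }, fun m => hc _, fun i m hm => ?_⟩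
  · rw [← hc, add_smul, ← hc, ← hc]
    rfl
  · rw [← hc, RingHom.id_apply, smul_eq_mul, mul_smul, ← hc]
    rfl
  · have h1 := hm y
    rw [hc (m.1 y), GrMod.smul_mem_deg_iff he.mem he.ne_zero] at h1
    rwa [zero_add]

variable [Finite ι]

/-- The section `G.delta y • m` depends on m only through its value at y. -/
theorem delta_smul_of_eq_smul {u m : M.sections} {y : ι} {s : SymmetricAlgebra k V}
    (h : m.1 y = s • u.1 y) : G.delta y • m = s • (G.delta y • u) := by
  apply Subtype.ext
  funext a
  change (G.delta y).1 a • m.1 a = s • ((G.delta y).1 a • u.1 a)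
  by_cases ha : a = y
  · subst ha
    rw [h, smul_comm]
  · rw [delta_of_ne ha, zero_smul, zero_smul, smul_zero]

theorem delta_smul_eq_zero {m : M.sections} {y : ι} : G.delta y • m = 0 ↔ m.1 y = 0 := by
  constructor
  · intro h
    have h1 : (G.delta y).1 y • m.1 y = 0 := congrArg (fun f : M.sections => f.1 y) h
    rw [delta_self] at h1
    exact (smul_eq_zero.mp h1).resolve_left (labelProd_ne_zero y)
  · intro h
    rw [delta_smul_of_eq_smul (u := m) (s := 0) (by rw [h, zero_smul]), zero_smul]

theorem delta_smul_mem {u : M.sections} (hu : u ∈ M.sectionsDeg 0) (y : ι) :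
    G.delta y • u ∈ M.sectionsDeg (G.numEdges y) := by
  intro a
  rw [smul_val]
  by_cases ha : a = y
  · subst ha
    rw [delta_self]
    simpa using (M.stalk a).smul_mem _ _ _ _ (labelProd_mem a) (hu a)
  · rw [delta_of_ne ha, zero_smul]
    exact zero_mem _

/-- The values of a linear form at the contributions of the two vertices of an edge are linked by
a residue condition. -/
theorem labelS_dvd_of_apply_delta_eq_zero (hG : G.IsGKM)
    (F : M.sections →ₗ[SymmetricAlgebra k V] SymmetricAlgebra k V) {u m : M.sections} {x y : ι}
    (h : G.graph.Adj x y) {s : SymmetricAlgebra k V} (hm : m.1 y = s • u.1 y)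
    (hy : IsUnit (F (G.delta y • u))) (hx : F (G.delta x • m) = 0) :
    G.labelS (G.edge h) ∣ s := by
  have h1 := congrArg (fun z : G.structureAlgebra => F (z • m)) (labelS_smul_edgeDelta h)
  simp only [add_smul, smul_assoc, map_add, LinearMap.map_smul, hx,
    delta_smul_of_eq_smul hm, mul_zero, zero_add, smul_eq_mul] at h1
  have h2 : G.labelS (G.edge h) ∣ G.labelProdErase x (G.edge h) * (s * F (G.delta y • u)) :=
    ⟨_, h1.symm⟩
  have h3 := ((prime_labelS _).dvd_or_dvd h2).resolve_left
    (hG.not_dvd_labelProdErase (Sym2.mem_mk_left x y))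
  exact (hy.dvd_mul_right).mp h3

theorem apply_delta_ne_zero_of_adj (hG : G.IsGKM)
    (F : M.sections →ₗ[SymmetricAlgebra k V] SymmetricAlgebra k V) {u : M.sections} {x y : ι}
    (h : G.graph.Adj x y) (hy : IsUnit (F (G.delta y • u))) : F (G.delta x • u) ≠ 0 := fun h0 =>
  (prime_labelS (G.edge h)).not_isUnit (isUnit_of_dvd_one
    (labelS_dvd_of_apply_delta_eq_zero hG F (m := u) h (one_smul _ _).symm hy h0))

variable {t : ι}

/-- Since F(δ_x u) is a unit, B^x is spanned by u_x and values of sections m with F(δ_x m) = 0. The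
residue condition makes such m_x vanish on all upward edges, so they lie in a superfluous submodule.
-/
theorem IsBradenMacPherson.span_of_isUnit_apply_delta (hM : M.IsBradenMacPherson t)
    (ht : ∀ y, y ≤ t) (hG : G.IsGKM)
    (F : M.sections →ₗ[SymmetricAlgebra k V] SymmetricAlgebra k V) {u : M.sections}
    (hu : u ∈ M.sectionsDeg 0) {x : ι} (hxt : x ≠ t) (hx : IsUnit (F (G.delta x • u)))
    (hup : ∀ y, G.graph.Adj x y → x < y →
      GrMod.IsFreeGenerator (u.1 y) ∧ IsUnit (F (G.delta y • u))) (a : M.stalk x) :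
    ∃ s : SymmetricAlgebra k V, a = s • u.1 x := by
  have htop : Submodule.span (SymmetricAlgebra k V) {u.1 x} = ⊤ := by
    refine hM.superfluous x hxt _ (GrMod.isHomogeneous_span_singleton (hu x)) ?_
    rw [eq_top_iff]
    intro c _
    obtain ⟨m, rfl⟩ := hM.exists_section ht x c
    obtain ⟨r, hr⟩ := hx.exists_left_inv
    let s := F (G.delta x • m) * r
    have hF : F (G.delta x • (m - s • u)) = 0 := by
      rw [smul_sub, smul_smul_comm, map_sub, LinearMap.map_smul, smul_eq_mul, mul_assoc, hr, mul_one,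
        sub_self]
    refine Submodule.mem_sup.mpr ⟨s • u.1 x, Submodule.smul_mem _ _
      (Submodule.mem_span_singleton_self _), (m - s • u).1 x, ?_, by
        change s • u.1 x + (m.1 x - s • u.1 x) = m.1 x
        abel⟩
    rw [LinearMap.mem_ker]
    funext y
    obtain ⟨hfree, hunit⟩ := hup y.1 y.2.1 y.2.2
    obtain ⟨s', hs'⟩ := hfree.span ((m - s • u).1 y.1)
    obtain ⟨q, rfl⟩ := labelS_dvd_of_apply_delta_eq_zero hG F y.2.1 hs' hunit hF
    change M.resL y.2.1 ((m - s • u).1 x) = 0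
    rw [(m - s • u).2 x y.1 y.2.1, hs', map_smul, mul_smul, M.label_smul]
  obtain ⟨s, hs⟩ := Submodule.mem_span_singleton.mp (htop ▸ Submodule.mem_top : a ∈ _)
  exact ⟨s, hs.symm⟩

/-- A section that is supported at `y` is a multiple of `G.delta y`. -/
theorem IsBradenMacPherson.exists_eq_smul_delta (hM : M.IsBradenMacPherson t) (hG : G.IsGKM)
    {u : M.sections} {y : ι} (hu : ∀ z, y ≤ z → GrMod.IsFreeGenerator (u.1 z)) {b : M.sections}
    (hb : ∀ z, z ≠ y → b.1 z = 0) :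
    ∃ s : SymmetricAlgebra k V, b = (s • G.delta y) • u := by
  obtain ⟨s, hs⟩ := (hu y le_rfl).span (b.1 y)
  obtain ⟨q, rfl⟩ : G.labelProd y ∣ s := by
    refine hG.labelProd_dvd ?_
    rintro ⟨e, hadj⟩ hy
    obtain ⟨z, rfl⟩ := hy
    have h : G.graph.Adj y z := (SimpleGraph.mem_edgeSet G.graph).mp hadj
    change G.labelS (G.edge h) ∣ s
    -- The kernel of restriction is known only at the upper end of an edge. If z is that end, s u_y
    -- and s u_z have the same restriction, so s is tested against u_z instead.
    rcases G.comparable y z h with hlt | hlt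
    · refine hM.resR_smul_eq_zero_imp h hlt (hu z hlt.le) ?_
      rw [map_smul, ← u.2 y z h, ← map_smul, ← hs, b.2 y z h, hb z h.ne', map_zero]
    · have h1 := hM.resR_smul_eq_zero_imp (s := s) h.symm hlt (hu y le_rfl) (by
        rw [← hs, ← b.2 z y h.symm, hb z h.ne', map_zero])
      have hedge : G.edge h.symm = G.edge h := Subtype.ext Sym2.eq_swap
      rwa [hedge] at h1
  refine ⟨q, Subtype.ext (funext fun a => ?_)⟩
  change b.1 a = (q * (G.delta y).1 a) • u.1 a
  by_cases ha : a = y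
  · subst ha
    rw [hs, delta_self, mul_comm]
  · rw [hb a ha, delta_of_ne ha, mul_zero, zero_smul]

end Sheaf

end MomentGraph

end MomentGraphTheory

/-! ### The two implications. -/

open MomentGraphTheory in
theorem MomentGraphTheory.MomentGraph.Sheaf.IsBradenMacPherson.numEdges_eq {k : Type u} [Field k]
    {V : Type v} [AddCommGroup V] [Module k V] {ι : Type w} [PartialOrder ι] [Finite ι]
    {G : MomentGraph k V ι} (hG : G.IsGKM) {t : ι} (ht : ∀ y, y ≤ t) {B : G.Sheaf}
    (hB : B.IsBradenMacPherson t) {l : ℤ} (hl : G.IsSelfDual B.sectionsDeg l) {x : ι}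
    (hx : (B.stalk x).IsIso (GrMod.ring k V)) {y : ι} (hxy : x ≤ y) :
    (G.numEdges y : ℤ) = l := by
  obtain ⟨Φ, hdeg, hZ⟩ := hl
  obtain ⟨e, he⟩ := GrMod.isIso_ring_iff.mp hx
  obtain ⟨u, hu, rfl⟩ := hB.exists_section_of_mem_deg ht he.mem
  have hfree : ∀ z, x ≤ z → GrMod.IsFreeGenerator (u.1 z) := fun z hz =>
    hB.isFreeGenerator_of_le ht hz hu he
  obtain ⟨g, hg, hg0⟩ := Sheaf.exists_coeff (hfree y hxy)
  obtain ⟨b, hb⟩ := Φ.surjective ⟨g, le_iSup (homDeg (k := k) (V := V) B.sectionsDeg) 0 hg0⟩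
  have hg' : (Φ b).1 = g := congrArg Subtype.val hb
  -- For z ≠ y the form Φ(δ_z b) sends m to g(δ_z m), which is 0 because δ_z m vanishes at y.
  have hsupp : ∀ z, z ≠ y → b.1 z = 0 := by
    intro z hz
    rw [← Sheaf.delta_smul_eq_zero, ← map_eq_zero_iff Φ Φ.injective]
    apply Subtype.ext
    ext m
    change (Φ (G.delta z • b)).1 m = 0
    rw [hZ, hg']
    refine GrMod.smul_eq_zero_imp (m := u.1 y) ?_ (hfree y hxy).ne_zero
    rw [← hg, Sheaf.smul_val, delta_of_ne hz.symm, zero_smul]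
  obtain ⟨s, rfl⟩ := hB.exists_eq_smul_delta hG (fun z hz => hfree z (hxy.trans hz)) hsupp
  have h1 : s * (Φ u).1 (G.delta y • u) = 1 := by
    have h2 : g u = 1 := by
      refine sub_eq_zero.mp (GrMod.smul_eq_zero_imp (m := u.1 y) ?_ (hfree y hxy).ne_zero)
      rw [sub_smul, ← hg, one_smul, sub_self]
    rw [← h2, ← hg', hZ, smul_assoc, LinearMap.map_smul, smul_eq_mul]
  have h3 : (Φ u).1 ∈ homDeg (k := k) (V := V) B.sectionsDeg (-l) :=
    (hdeg (-l) u).mp (by rwa [add_neg_cancel])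
  have h4 := eq_zero_of_isUnit_of_mem_symDeg (h3 _ _ (Sheaf.delta_smul_mem hu y))
    (IsUnit.of_mul_eq_one_right _ h1)
  omega

open MomentGraphTheory in
theorem MomentGraphTheory.MomentGraph.Sheaf.IsBradenMacPherson.isIso_ring {k : Type u} [Field k]
    {V : Type v} [AddCommGroup V] [Module k V] {ι : Type w} [PartialOrder ι] [Finite ι]
    {G : MomentGraph k V ι} (hG : G.IsGKM) {t : ι} (ht : ∀ y, y ≤ t) {B : G.Sheaf}
    (hB : B.IsBradenMacPherson t) {l : ℤ} (hl : G.IsSelfDual B.sectionsDeg l) {x : ι}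
    (hx : ∀ y, x ≤ y → (G.numEdges y : ℤ) = l) : (B.stalk x).IsIso (GrMod.ring k V) := by
  obtain ⟨Φ, hdeg, hZ⟩ := hl
  obtain ⟨e, he⟩ := GrMod.isIso_ring_iff.mp hB.top
  obtain ⟨u, hu, rfl⟩ := hB.exists_section_of_mem_deg ht he.mem
  have hF : (Φ u).1 ∈ homDeg (k := k) (V := V) B.sectionsDeg (-l) :=
    (hdeg (-l) u).mp (by rwa [add_neg_cancel])
  have hunit : ∀ y, x ≤ y → (Φ u).1 (G.delta y • u) ≠ 0 → IsUnit ((Φ u).1 (G.delta y • u)) := by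
    intro y hxy
    have h := hF _ _ (Sheaf.delta_smul_mem hu y)
    rw [hx y hxy, neg_add_cancel] at h
    exact isUnit_of_mem_symDeg_zero h
  have key : ∀ y, x ≤ y →
      GrMod.IsFreeGenerator (u.1 y) ∧ (Φ u).1 (G.delta y • u) ≠ 0 := by
    intro y hxy
    induction y using WellFoundedGT.induction with
    | ind y ih =>
      by_cases hyt : y = t
      · subst hyt
        -- At t every δ_t m is a multiple of δ_t u, so F(δ_t u) = 0 would give Φ(δ_t u) = 0,
        -- contradicting injectivity of Φ.
        refine ⟨he, fun h0 => he.ne_zero ?_⟩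
        rw [← Sheaf.delta_smul_eq_zero, ← map_eq_zero_iff Φ Φ.injective]
        apply Subtype.ext
        ext m
        change (Φ (G.delta y • u)).1 m = 0
        obtain ⟨s, hs⟩ := he.span (m.1 y)
        rw [hZ, Sheaf.delta_smul_of_eq_smul hs, map_smul, h0, smul_zero]
      · have hup : ∀ z, y < z → GrMod.IsFreeGenerator (u.1 z) ∧
            IsUnit ((Φ u).1 (G.delta z • u)) := fun z hyz =>
          have hxz := hxy.trans hyz.le
          ⟨(ih z hyz hxz).1, hunit z hxz (ih z hyz hxz).2⟩
        obtain ⟨z, hz, hyz⟩ := G.exists_adj_lt (ht y) hyt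
        have hne := Sheaf.apply_delta_ne_zero_of_adj hG (Φ u).1 hz (hup z hyz).2
        refine ⟨⟨hu y, fun h0 => hne ?_, ?_⟩, hne⟩
        · rw [Sheaf.delta_smul_eq_zero.mpr h0, map_zero]
        · exact hB.span_of_isUnit_apply_delta ht hG (Φ u).1 hu hyt (hunit y hxy hne)
            fun z _ hyz => hup z hyz
  exact GrMod.isIso_ring_iff.mpr ⟨_, (key x le_rfl).1⟩

theorem mainTheorem1 {k : Type u} [Field k] {V : Type v} [AddCommGroup V] [Module k V]
    [FiniteDimensional k V] {ι : Type w} [PartialOrder ι] [Finite ι]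
    (G : MomentGraphTheory.MomentGraph k V ι) (hG : G.IsGKM) (t : ι) (ht : ∀ y, y ≤ t)
    (B : G.Sheaf) (hB : B.IsBradenMacPherson t) (l : ℤ)
    (hl : G.IsSelfDual B.sectionsDeg l) (x : ι) :
    (B.stalk x).IsIso (MomentGraphTheory.GrMod.ring k V) ↔ ∀ y, x ≤ y → (G.numEdges y : ℤ) = l :=
  ⟨fun h _ hxy => hB.numEdges_eq hG ht hl h hxy, fun h => hB.isIso_ring hG ht hl h⟩
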